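/- A $2$-edge-coloured multigraph is a finite loopless multigraph each of whose edges has one of two colours, such that no two parallel edges have the same colour. A proper Hamiltonian path is a path containing all the vertices in which any two consecutive edges have different colours. Let $n \ge 8$ be an integer. Every $2$-edge-coloured multigraph with $n$ vertices and at least $\binom{n}{2}+\binom{n-2}{2}+1$ edges has a proper Hamiltonian path. The bound on the number of edges is tight for odd $n$: for every odd $n \ge 8$ there is a connected $2$-edge-coloured multigraph with $n$ vertices and exactly $\binom{n}{2}+\binom{n-2}{2}$ edges that has no proper Hamiltonian path. -/

import Mathlib

universe u v

/-- A loopless multigraph with vertex set `V` and edge set `E`, whose edges are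
coloured with `c` colours in such a way that no two parallel edges have the same colour. -/
structure EdgeColouredMultigraph (V : Type*) (E : Type*) (c : ℕ) where
  /-- the unordered pair of end vertices of an edge -/
  ends : E → Sym2 V
  /-- there are no loops -/
  not_isDiag : ∀ e, ¬ (ends e).IsDiag
  /-- the colour of an edge -/
  colour : E → Fin c
  /-- parallel edges of the same colour coincide -/
  eq_of_parallel : ∀ e f, ends e = ends f → colour e = colour f → e = f

namespace EdgeColouredMultigraph

/-- The underlying simple graph: two vertices are adjacent if at least one edge joins them. -/
def underlying {V E : Type*} {c : ℕ} (G : EdgeColouredMultigraph V E c) : SimpleGraph V where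
  Adj x y := ∃ e, G.ends e = s(x, y)
  symm := ⟨fun _ _ ⟨e, he⟩ => ⟨e, he.trans Sym2.eq_swap⟩⟩
  loopless := ⟨fun _ ⟨e, he⟩ => G.not_isDiag e (by rw [he]; rfl)⟩

/-- A path with `k` edges: pairwise distinct vertices `v₀, …, vₖ` and, for each `i < k`, an edge
joining `vᵢ` to `vᵢ₊₁`. -/
structure Path {V E : Type*} {c : ℕ} (G : EdgeColouredMultigraph V E c) (k : ℕ) where
  /-- the vertices, in order -/
  vert : Fin (k + 1) → V
  /-- the edges, in order -/
  edge : Fin k → E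
  vert_injective : Function.Injective vert
  ends_edge : ∀ i : Fin k, G.ends (edge i) = s(vert i.castSucc, vert i.succ)

/-- A path is Hamiltonian if it contains all vertices. -/
def Path.IsHamiltonian {V E : Type*} {c : ℕ} {G : EdgeColouredMultigraph V E c} {k : ℕ}
    (P : G.Path k) : Prop :=
  Function.Surjective P.vert

/-- A path is proper if any two consecutive edges have different colours. -/
def Path.IsProper {V E : Type*} {c : ℕ} {G : EdgeColouredMultigraph V E c} {k : ℕ}
    (P : G.Path k) : Prop :=
  ∀ i j : Fin k, (i : ℕ) + 1 = (j : ℕ) → G.colour (P.edge i) ≠ G.colour (P.edge j)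

/-- The multigraph has a proper Hamiltonian path. -/
def HasProperHamiltonianPath {V E : Type*} {c : ℕ} (G : EdgeColouredMultigraph V E c) : Prop :=
  ∃ (k : ℕ) (P : G.Path k), P.IsHamiltonian ∧ P.IsProper

end EdgeColouredMultigraph

/-! Pass to the missing edges: `N c` holds the pairs not joined in colour `c`. The edge hypothesis
says that at most `2 * n - 4` coloured edges are missing, and `hasPath_of_degSum_le` finds an
alternating Hamiltonian path by induction from `n - 2` to `n`. An alternating path `x`, `y`, `z` is
contracted to one vertex that keeps one colour of `x` and takes the other from `z`; a path through
this vertex expands again (`hasPath_of_contract`). The contraction must destroy enough missing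
edges, usually four, to meet the bound for `n - 2`. Such a triple is found in `exists_isReducible`.
Averaging gives a vertex with many missing edges to serve as the middle, unless some vertex has no
edge at all in one colour. That vertex alone uses up `n - 1` missing edges, so few remain elsewhere.
For tightness, let two vertices have edges of one colour only. Both must be ends of the path, but an
even number of alternating edges starts and ends in different colours. -/

namespace AlternatingPath

variable {V : Type*}

/-! ### Degrees inside a vertex set -/

open Classical in
/-- The number of neighbours of `u` inside `S`. -/
noncomputable def degIn (N : SimpleGraph V) (S : Finset V) (u : V) : ℕ :=
  (S.filter fun v => N.Adj u v).card

/-- The sum of the degrees of the subgraph induced on `S`. -/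
noncomputable def degSum (N : SimpleGraph V) (S : Finset V) : ℕ :=
  ∑ u ∈ S, degIn N S u

lemma degIn_erase_of_adj [DecidableEq V] {N : SimpleGraph V} {S : Finset V} {a u : V}
    (ha : a ∈ S) (h : N.Adj u a) : degIn N S u = degIn N (S.erase a) u + 1 := by
  classical
  unfold degIn
  rw [Finset.filter_erase, Finset.card_erase_add_one]
  simp [ha, h]

lemma degIn_erase_of_not_adj [DecidableEq V] {N : SimpleGraph V} {S : Finset V} {a u : V}
    (h : ¬ N.Adj u a) : degIn N (S.erase a) u = degIn N S u := by
  classical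
  unfold degIn
  rw [Finset.filter_erase, Finset.erase_eq_of_notMem]
  simp [h]

lemma degIn_erase_le [DecidableEq V] (N : SimpleGraph V) (S : Finset V) (a u : V) :
    degIn N (S.erase a) u ≤ degIn N S u := by
  classical
  unfold degIn
  exact Finset.card_le_card (Finset.filter_subset_filter _ (Finset.erase_subset _ _))

lemma degSum_erase [DecidableEq V] (N : SimpleGraph V) {S : Finset V} {a : V} (ha : a ∈ S) :
    degSum N S = degSum N (S.erase a) + 2 * degIn N S a := by
  classical
  have h1 : ∑ u ∈ S.erase a, degIn N S u
      = ∑ u ∈ S.erase a, (degIn N (S.erase a) u + if N.Adj a u then 1 else 0) := by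
    refine Finset.sum_congr rfl fun u _ => ?_
    split_ifs with h
    · exact degIn_erase_of_adj ha h.symm
    · rw [degIn_erase_of_not_adj fun h' => h h'.symm, add_zero]
  have h2 : (∑ u ∈ S.erase a, if N.Adj a u then 1 else 0) = degIn N S a := by
    rw [← Finset.card_filter, ← degIn_erase_of_not_adj (a := a) (N.irrefl)]
    rfl
  unfold degSum at *
  rw [← Finset.add_sum_erase S _ ha, h1, Finset.sum_add_distrib, h2]
  ring

lemma even_degSum (N : SimpleGraph V) (S : Finset V) : Even (degSum N S) := by
  classical
  induction S using Finset.induction_on with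
  | empty => simp [degSum]
  | insert a S ha ih =>
    rw [degSum_erase N (Finset.mem_insert_self a S), Finset.erase_insert ha]
    exact ih.add (even_two_mul _)

lemma degSum_comap [DecidableEq V] (N : SimpleGraph V) (σ : Equiv.Perm V) (S : Finset V) :
    degSum (N.comap σ) S = degSum N (S.map σ.toEmbedding) := by
  classical
  unfold degSum degIn
  rw [Finset.sum_map]
  refine Finset.sum_congr rfl fun u _ => ?_
  rw [Finset.filter_map, Finset.card_map]
  rfl

lemma degIn_pos {N : SimpleGraph V} {S : Finset V} {u v : V} (hv : v ∈ S) (h : N.Adj u v) :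
    1 ≤ degIn N S u := by
  classical
  exact Finset.card_pos.mpr ⟨v, by simp [hv, h]⟩

lemma exists_adj_of_degIn_pos {N : SimpleGraph V} {S : Finset V} {u : V}
    (h : 1 ≤ degIn N S u) : ∃ v ∈ S, N.Adj u v := by
  classical
  obtain ⟨v, hv⟩ := Finset.card_pos.mp h
  exact ⟨v, by simpa using hv⟩

lemma two_mul_degIn_le_degSum (N : SimpleGraph V) {S : Finset V} {u : V} (hu : u ∈ S) :
    2 * degIn N S u ≤ degSum N S := by
  classical
  rw [degSum_erase N hu]
  exact Nat.le_add_left _ _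

open Classical in
lemma card_filter_not_adj (N : SimpleGraph V) {S : Finset V} {u : V} (hu : u ∈ S) :
    ((S.erase u).filter fun v => ¬ N.Adj u v).card + degIn N S u + 1 = S.card := by
  have h := Finset.card_filter_add_card_filter_not (s := S.erase u) (fun v => N.Adj u v)
  rw [← degIn_erase_of_not_adj (a := u) N.irrefl, ← Finset.card_erase_add_one hu]
  unfold degIn
  omega

/-- If no edge joins the outside of the closed neighbourhood of `y`, then the degree sum is
bounded by that of a complete graph on the closed neighbourhood. -/
lemma degSum_le_of_forall_not_adj {N : SimpleGraph V} {S : Finset V} {y : V} (hy : y ∈ S)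
    (h : ∀ u ∈ S, u ≠ y → ¬ N.Adj y u → degIn N S u = 0) :
    degSum N S ≤ (degIn N S y + 1) * degIn N S y := by
  classical
  set C := insert y (S.filter fun v => N.Adj y v) with hC
  have hcard : C.card = degIn N S y + 1 := by
    rw [hC, Finset.card_insert_of_notMem (by simp)]; rfl
  have hCS : C ⊆ S := by
    rw [hC]; exact Finset.insert_subset hy (Finset.filter_subset _ _)
  have hout : ∀ u ∈ S, u ∉ C → degIn N S u = 0 := by
    intro u hu huC
    simp only [hC, Finset.mem_insert, Finset.mem_filter, not_or, not_and] at huC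
    exact h u hu huC.1 (huC.2 hu)
  have hsum : degSum N S = ∑ u ∈ C, degIn N S u :=
    (Finset.sum_subset hCS hout).symm
  rw [hsum, ← hcard, ← smul_eq_mul]
  refine Finset.sum_le_card_nsmul _ _ _ fun u hu => ?_
  have hle : degIn N S u ≤ (C.erase u).card := by
    refine Finset.card_le_card fun v hv => ?_
    simp only [Finset.mem_filter] at hv
    refine Finset.mem_erase.mpr ⟨hv.2.ne', ?_⟩
    by_contra hvC
    have := degIn_pos (hCS hu) hv.2.symm
    rw [hout v hv.1 hvC] at this
    omega
  rw [Finset.card_erase_of_mem hu, hcard] at hle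
  simpa using hle

/-! ### Alternating paths and contraction -/

/-- `q` may follow `p` on an alternating path avoiding the edges of `N`; the second component
of a pair is the colour of the edge by which the path leaves the vertex. -/
def Step (N : Bool → SimpleGraph V) (p q : V × Bool) : Prop :=
  q.2 = !p.2 ∧ ¬ (N p.2).Adj p.1 q.1

/-- There is an alternating path with vertex set `S`, where the edges of colour `c` are the
non-edges of `N c`. -/
def HasPath (N : Bool → SimpleGraph V) (S : Finset V) : Prop :=
  ∃ L : List (V × Bool), (L.map Prod.fst).Nodup ∧ (∀ v, v ∈ L.map Prod.fst ↔ v ∈ S) ∧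
    L.IsChain (Step N)

/-- Contract the path `x`, `y`, `z` into `x`: the vertex `x` receives the `c`-coloured
adjacencies of `z`. -/
def contract [DecidableEq V] (N : Bool → SimpleGraph V) (c : Bool) (x z : V) :
    Bool → SimpleGraph V :=
  fun d => if d = c then (N d).comap (Equiv.swap x z) else N d

lemma isChain_of_mem {α : Type*} {R R' : α → α → Prop} {l : List α}
    (h : ∀ a ∈ l, ∀ b ∈ l, R a b → R' a b) (hl : l.IsChain R) : l.IsChain R' := by
  induction hl with
  | nil => exact .nil
  | singleton a => exact .singleton a
  | cons_cons hr _ ih =>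
    refine .cons_cons (h _ (by simp) _ (by simp) hr) (ih fun a ha b hb => h a ?_ b ?_)
    · exact List.mem_cons_of_mem _ ha
    · exact List.mem_cons_of_mem _ hb

/-- At the contracted vertex the `c`-edge belongs to `z` and the other edge to `x`. So `x` is
replaced by `x`, `y`, `z` or by `z`, `y`, `x`, according to the colour by which the path leaves it.
-/
lemma hasPath_of_contract [DecidableEq V] {N : Bool → SimpleGraph V} {S : Finset V} {c : Bool}
    {x y z : V} (hx : x ∈ S) (hy : y ∈ S) (hz : z ∈ S) (hxy : x ≠ y) (hyz : y ≠ z) (hxz : x ≠ z)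
    (h1 : ¬ (N c).Adj x y) (h2 : ¬ (N !c).Adj y z)
    (h : HasPath (contract N c x z) ((S.erase y).erase z)) : HasPath N S := by
  obtain ⟨L, hnd, hmem, hch⟩ := h
  have hxL : x ∈ L.map Prod.fst := by rw [hmem]; simp [*]
  obtain ⟨⟨x', d⟩, hxd, rfl⟩ := List.mem_map.mp hxL
  obtain ⟨l₁, l₂, rfl⟩ := List.append_of_mem hxd
  simp only at hx hxy hxz h1 hch hnd hmem
  have hz' : z ∉ (l₁ ++ (x', d) :: l₂).map Prod.fst := by rw [hmem]; simp
  have hy' : y ∉ (l₁ ++ (x', d) :: l₂).map Prod.fst := by rw [hmem]; simp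
  simp only [List.map_append, List.map_cons, List.mem_append, List.mem_cons, not_or] at hz' hy'
  have hx1 : x' ∉ l₁.map Prod.fst ∧ x' ∉ l₂.map Prod.fst := by
    simp only [List.map_append, List.map_cons, List.nodup_append, List.nodup_cons] at hnd
    exact ⟨fun h => hnd.2.2 x' h x' (by simp) rfl, hnd.2.1.1⟩
  have hstep : ∀ p q : V × Bool, p.1 ≠ x' → p.1 ≠ z → q.1 ≠ x' → q.1 ≠ z →
      Step (contract N c x' z) p q → Step N p q := by
    rintro ⟨p, e⟩ ⟨q, e'⟩ a1 a2 a3 a4 ⟨b1, b2⟩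
    refine ⟨b1, ?_⟩
    unfold contract at b2
    split_ifs at b2
    · simpa [Equiv.swap_apply_of_ne_of_ne a1 a2, Equiv.swap_apply_of_ne_of_ne a3 a4] using b2
    · exact b2
  have hne : ∀ l : List (V × Bool), x' ∉ l.map Prod.fst → z ∉ l.map Prod.fst →
      ∀ a ∈ l, a.1 ≠ x' ∧ a.1 ≠ z := by
    intro l m1 m2 a ha
    exact ⟨fun e => m1 (e ▸ List.mem_map_of_mem ha), fun e => m2 (e ▸ List.mem_map_of_mem ha)⟩
  have hn1 := hne l₁ hx1.1 hz'.1
  have hn2 := hne l₂ hx1.2 hz'.2.2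
  rw [List.isChain_append] at hch
  obtain ⟨hc1, hc2, hlast⟩ := hch
  rw [List.isChain_cons] at hc2
  obtain ⟨hhead, hc2⟩ := hc2
  replace hc1 : l₁.IsChain (Step N) := isChain_of_mem (fun a ha b hb =>
    hstep a b (hn1 a ha).1 (hn1 a ha).2 (hn1 b hb).1 (hn1 b hb).2) hc1
  replace hc2 : l₂.IsChain (Step N) := isChain_of_mem (fun a ha b hb =>
    hstep a b (hn2 a ha).1 (hn2 a ha).2 (hn2 b hb).1 (hn2 b hb).2) hc2
  have hmem' : ∀ v, (v ∈ l₁.map Prod.fst ∨ v = x' ∨ v ∈ l₂.map Prod.fst) ↔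
      (v ≠ z ∧ v ≠ y ∧ v ∈ S) := by
    intro v
    have := hmem v
    simpa only [List.map_append, List.map_cons, List.mem_append, List.mem_cons,
      Finset.mem_erase] using this
  by_cases hd : d = c
  · subst hd
    refine ⟨l₁ ++ (x', d) :: (y, !d) :: (z, d) :: l₂, ?_, ?_, ?_⟩
    · simp only [List.map_append, List.map_cons, List.nodup_append, List.nodup_cons,
        List.mem_cons] at hnd ⊢
      grind
    · intro v
      have := hmem' v
      simp only [List.map_append, List.map_cons, List.mem_append, List.mem_cons]
      grind
    · rw [List.isChain_append]
      refine ⟨hc1, ?_, ?_⟩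
      · refine .cons_cons ⟨rfl, h1⟩ (.cons_cons ⟨by simp, h2⟩ ?_)
        rw [List.isChain_cons]
        refine ⟨fun q hq => ?_, hc2⟩
        obtain ⟨b1, b2⟩ := hhead q hq
        have := hn2 q (List.mem_of_mem_head? hq)
        refine ⟨b1, ?_⟩
        simpa [contract, Equiv.swap_apply_of_ne_of_ne this.1 this.2] using b2
      · intro a ha b hb
        simp only [List.head?_cons, Option.mem_some_iff] at hb
        subst hb
        obtain ⟨b1, b2⟩ := hlast a ha (x', d) (by simp)
        refine ⟨b1, ?_⟩
        have : a.2 ≠ d := by intro h; simp [h] at b1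
        simpa [contract, this] using b2
  · have hd' : d = !c := by cases d <;> cases c <;> simp_all
    subst hd'
    refine ⟨l₁ ++ (z, !c) :: (y, c) :: (x', !c) :: l₂, ?_, ?_, ?_⟩
    · simp only [List.map_append, List.map_cons, List.nodup_append, List.nodup_cons,
        List.mem_cons] at hnd ⊢
      grind
    · intro v
      have := hmem' v
      simp only [List.map_append, List.map_cons, List.mem_append, List.mem_cons]
      grind
    · rw [List.isChain_append]
      refine ⟨hc1, ?_, ?_⟩
      · refine .cons_cons ⟨by simp, fun h => h2 h.symm⟩ (.cons_cons ⟨rfl, fun h => h1 h.symm⟩ ?_)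
        rw [List.isChain_cons]
        refine ⟨fun q hq => ?_, hc2⟩
        obtain ⟨b1, b2⟩ := hhead q hq
        refine ⟨b1, ?_⟩
        simpa [contract] using b2
      · intro a ha b hb
        simp only [List.head?_cons, Option.mem_some_iff] at hb
        subst hb
        obtain ⟨b1, b2⟩ := hlast a ha (x', !c) (by simp)
        refine ⟨b1, ?_⟩
        have h3 : a.2 = c := by simpa using b1.symm
        have := hn1 a (List.mem_of_mem_getLast? ha)
        simpa [contract, h3, Equiv.swap_apply_of_ne_of_ne this.1 this.2] using b2

/-- Contracting amounts to deleting `x`, `y` in colour `c` and `y`, `z` in the other colour. By `h1`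
and `h2` no deleted edge is counted twice. -/
lemma degSum_contract [DecidableEq V] (N : Bool → SimpleGraph V) {S : Finset V} {c : Bool}
    {x y z : V} (hx : x ∈ S) (hy : y ∈ S) (hz : z ∈ S) (hxy : x ≠ y) (hyz : y ≠ z) (hxz : x ≠ z)
    (h1 : ¬ (N c).Adj x y) (h2 : ¬ (N !c).Adj y z) :
    degSum (contract N c x z c) ((S.erase y).erase z)
        + degSum (contract N c x z (!c)) ((S.erase y).erase z)
        + 2 * (degIn (N c) S x + degIn (N c) S y + degIn (N !c) S y + degIn (N !c) S z)
      = degSum (N c) S + degSum (N !c) S := by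
  have hmap : ((S.erase y).erase z).map (Equiv.swap x z).toEmbedding = (S.erase y).erase x := by
    ext v
    rw [Finset.mem_map_equiv, Equiv.symm_swap]
    rcases eq_or_ne v x with rfl | hvx
    · simp
    rcases eq_or_ne v z with rfl | hvz
    · simp [*, hyz.symm, hxz.symm]
    · simp [Equiv.swap_apply_of_ne_of_ne hvx hvz, hvx, hvz]
  have e1 : contract N c x z c = (N c).comap (Equiv.swap x z) := by simp [contract]
  have e2 : contract N c x z (!c) = N !c := by simp [contract]
  rw [e1, e2, degSum_comap, hmap, degSum_erase (N c) hy, degSum_erase (N !c) hy,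
    degSum_erase (N c) (Finset.mem_erase.mpr ⟨hxy, hx⟩),
    degSum_erase (N !c) (Finset.mem_erase.mpr ⟨hyz.symm, hz⟩),
    degIn_erase_of_not_adj h1, degIn_erase_of_not_adj fun h => h2 h.symm]
  ring

/-! ### Finding a triple to contract -/

/-- `x`, `y`, `z` are distinct vertices of `S` forming an alternating path, and contracting
this path destroys at least `D` edges of `N`. -/
structure IsReducible (N : Bool → SimpleGraph V) (S : Finset V) (D : ℕ) (c : Bool)
    (x y z : V) : Prop where
  hx : x ∈ S
  hy : y ∈ S
  hz : z ∈ S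
  hxy : x ≠ y
  hyz : y ≠ z
  hxz : x ≠ z
  not_adj_left : ¬ (N c).Adj x y
  not_adj_right : ¬ (N !c).Adj y z
  le_degIn : D ≤ degIn (N c) S x + degIn (N c) S y + degIn (N !c) S y + degIn (N !c) S z

lemma exists_not_adj (N : SimpleGraph V) {S : Finset V} {u : V} (hu : u ∈ S)
    (h : degIn N S u + 2 ≤ S.card) : ∃ v ∈ S, v ≠ u ∧ ¬ N.Adj u v := by
  classical
  have := card_filter_not_adj N hu
  obtain ⟨v, hv⟩ := Finset.card_pos.mp
    (show 0 < ((S.erase u).filter fun v => ¬ N.Adj u v).card by omega)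
  simp only [Finset.mem_filter, Finset.mem_erase] at hv
  exact ⟨v, hv.1.2, hv.1.1, hv.2⟩

lemma card_le_of_forall_not_adj_eq (N : SimpleGraph V) {S : Finset V} {u w : V} (hu : u ∈ S)
    (h : ∀ v ∈ S, v ≠ u → ¬ N.Adj u v → v = w) : S.card ≤ degIn N S u + 2 := by
  classical
  have := card_filter_not_adj N hu
  have : ((S.erase u).filter fun v => ¬ N.Adj u v).card ≤ 1 := by
    refine (Finset.card_le_card fun v hv => ?_).trans (Finset.card_singleton w).le
    simp only [Finset.mem_filter, Finset.mem_erase] at hv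
    simpa using h v hv.1.2 hv.1.1 hv.2
  omega

lemma exists_isReducible_of_le_degIn {N : Bool → SimpleGraph V} {S : Finset V} {T D : ℕ}
    (hm : 3 ≤ S.card) (hT : degSum (N true) S + degSum (N false) S = 2 * T)
    (hiso : ∀ c, ∀ u ∈ S, degIn (N c) S u + 2 ≤ S.card) (hTm : T + 4 ≤ 2 * S.card)
    (hD : D + 1 ≤ S.card) {y : V} (hy : y ∈ S)
    (hyD : D ≤ degIn (N true) S y + degIn (N false) S y) :
    ∃ c x y z, IsReducible N S D c x y z := by
  classical
  obtain ⟨w, hwS, hwy, hw⟩ := exists_not_adj (N true) hy (hiso true y hy)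
  by_cases hex : ∃ x ∈ S, ∃ z ∈ S, x ≠ y ∧ z ≠ y ∧ x ≠ z ∧ ¬ (N true).Adj y x ∧
      ¬ (N false).Adj y z
  · obtain ⟨x, hx, z, hz, h1, h2, h3, h4, h5⟩ := hex
    exact ⟨true, x, y, z, hx, hy, hz, h1, h2.symm, h3, fun h => h4 h.symm, h5, by
      simp only [Bool.not_true]; omega⟩
  -- The only obstruction is a single vertex that is the sole non-neighbour of `y` in both colours.
  -- Then `y` carries at least `2 * (S.card - 2)` edges of `N`, hence all of them by `hTm`, and that
  -- vertex can be the middle instead.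
  · push Not at hex
    have hf : ∀ v ∈ S, v ≠ y → ¬ (N false).Adj y v → v = w := by
      intro v hv hvy hn
      by_contra hvw
      exact hn (hex w hwS v hv hwy hvy (Ne.symm hvw) hw)
    obtain ⟨w', hw'S, hw'y, hw'⟩ := exists_not_adj (N false) hy (hiso false y hy)
    obtain rfl := hf w' hw'S hw'y hw'
    have ht : ∀ v ∈ S, v ≠ y → ¬ (N true).Adj y v → v = w' := by
      intro v hv hvy hn
      by_contra hvw
      exact hw' (hex v hv w' hwS hvy hwy hvw hn)
    have c1 := card_le_of_forall_not_adj_eq (N true) hy ht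
    have c2 := card_le_of_forall_not_adj_eq (N false) hy hf
    have s1 := degSum_erase (N true) hy
    have s2 := degSum_erase (N false) hy
    obtain ⟨z, hz⟩ := Finset.card_pos.mp (show 0 < ((S.erase y).erase w').card by
      rw [Finset.card_erase_of_mem (by simp [*]), Finset.card_erase_of_mem hy]; omega)
    simp only [Finset.mem_erase] at hz
    have hzy : (N false).Adj y z := by
      by_contra h
      exact hz.1 (hf z hz.2.2 hz.2.1 h)
    have hwz : ¬ (N false).Adj w' z := by
      intro h
      have := two_mul_degIn_le_degSum (N false) (Finset.mem_erase.mpr ⟨hwy, hwS⟩)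
      have := degIn_pos (N := N false) (S := S.erase y) (u := w')
        (Finset.mem_erase.mpr ⟨hz.2.1, hz.2.2⟩) h
      omega
    have := degIn_pos hy hzy.symm
    exact ⟨true, y, w', z, hy, hwS, hz.2.2, hwy.symm, hz.1.symm, hz.2.1.symm, hw, hwz, by
      simp only [Bool.not_true]; omega⟩

/-- A middle vertex of total degree `D - 1` falls short by one, which an end vertex with an edge of
`N` in the right colour supplies. Without such an end, all edges of `N c` lie in the closed `N
c`-neighbourhood of `y` for both `c`, too few by `hDT`. -/
lemma exists_isReducible_of_no_dominated {N : Bool → SimpleGraph V} {S : Finset V} {T D : ℕ}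
    (hm : 3 ≤ S.card) (hT : degSum (N true) S + degSum (N false) S = 2 * T)
    (hiso : ∀ c, ∀ u ∈ S, degIn (N c) S u + 2 ≤ S.card) (hTm : T + 4 ≤ 2 * S.card)
    (hD : D + 1 ≤ S.card)
    (hy : ∃ y ∈ S, D ≤ degIn (N true) S y + degIn (N false) S y + 1)
    (hDT : 1 ≤ D → D * (D - 1) < 2 * T) :
    ∃ c x y z, IsReducible N S D c x y z := by
  classical
  obtain ⟨y, hyS, hyD⟩ := hy
  rcases Nat.lt_or_ge (degIn (N true) S y + degIn (N false) S y) D with hlt | hge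
  swap
  · exact exists_isReducible_of_le_degIn hm hT hiso hTm hD hyS hge
  obtain ⟨c, u, huS, huy, hu, hdu⟩ : ∃ c, ∃ u ∈ S, u ≠ y ∧ ¬ (N c).Adj y u ∧
      1 ≤ degIn (N c) S u := by
    by_contra! hno
    have b : ∀ c, degSum (N c) S ≤ (degIn (N c) S y + 1) * degIn (N c) S y := fun c =>
      degSum_le_of_forall_not_adj hyS fun u hu huy hn => by
        have := hno c u hu huy hn
        omega
    have b1 := b true
    have b2 := b false
    have := hDT (by omega)
    obtain rfl : D = degIn (N true) S y + degIn (N false) S y + 1 := by omega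
    rw [Nat.add_sub_cancel] at this
    nlinarith [Nat.zero_le (degIn (N true) S y * degIn (N false) S y)]
  have hsum : degIn (N c) S y + degIn (N !c) S y + 1 = D := by
    cases c <;> simp only [Bool.not_true, Bool.not_false] <;> omega
  by_cases hv : ∃ v ∈ S, v ≠ y ∧ ¬ (N !c).Adj y v ∧ v ≠ u
  · obtain ⟨v, hvS, hvy, hn, hvu⟩ := hv
    exact ⟨c, u, y, v, huS, hyS, hvS, huy, hvy.symm, hvu.symm, fun h => hu h.symm, hn, by omega⟩
  -- Now `u` is the only possible last vertex. Then `y` has all its `D - 1` edges of `N` in colour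
  -- `!c`, so an `N c`-neighbour `t` of `u` can start the path and `u` end it.
  · push Not at hv
    have h1 := card_le_of_forall_not_adj_eq (N !c) hyS hv
    obtain ⟨w, hwS, hwy, hw⟩ := exists_not_adj (N !c) hyS (hiso (!c) y hyS)
    obtain rfl := hv w hwS hwy hw
    obtain ⟨t, htS, ht⟩ := exists_adj_of_degIn_pos hdu
    have hnone : ∀ v ∈ S, ¬ (N c).Adj y v := fun v hvS h => by
      have := degIn_pos hvS h
      omega
    have hty : t ≠ y := by
      rintro rfl
      exact hu ht.symm
    have := degIn_pos huS ht.symm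
    exact ⟨c, t, y, w, htS, hyS, hwS, hty, hwy.symm, ht.ne', fun h => hnone t htS h.symm, hw,
      by omega⟩

/-- A path through a vertex dominated in `N c` at its end. -/
lemma exists_isReducible_of_dominated_end [DecidableEq V] {N : Bool → SimpleGraph V}
    {S : Finset V} {D : ℕ} {c : Bool} {y u : V} (hy : y ∈ S)
    (hdom : ∀ v ∈ S, v ≠ y → (N c).Adj y v) (hu : u ∈ S) (huy : u ≠ y)
    (hn : ¬ (N !c).Adj y u) (hdeg : degIn (N c) (S.erase y) u + 3 ≤ S.card)
    (hD : D ≤ degIn (N !c) S y + degIn (N c) (S.erase y) u + degIn (N !c) (S.erase y) u + 2) :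
    ∃ c x y z, IsReducible N S D c x y z := by
  obtain ⟨x, hxS, hxu, hx⟩ := exists_not_adj (N c) (S := S.erase y) (u := u)
    (Finset.mem_erase.mpr ⟨huy, hu⟩) (by rw [Finset.card_erase_of_mem hy]; omega)
  obtain ⟨hxy, hxS⟩ := Finset.mem_erase.mp hxS
  have h1 := degIn_pos hy (hdom x hxS hxy).symm
  have h2 := degIn_erase_of_adj hy (hdom u hu huy).symm
  have h3 := degIn_erase_le (N !c) S y u
  exact ⟨c, x, u, y, hxS, hu, hy, hxu, huy, hxy, fun h => hx h.symm, fun h => hn h.symm, by omega⟩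

/-- Two of the four counted degrees are in colour `c`, and each gains the edge to `w`. -/
lemma IsReducible.of_erase [DecidableEq V] {N : Bool → SimpleGraph V} {S : Finset V} {D : ℕ}
    {c e : Bool} {w x y z : V} (hw : w ∈ S) (hdom : ∀ v ∈ S, v ≠ w → (N c).Adj w v)
    (h : IsReducible N (S.erase w) D e x y z) : IsReducible N S (D + 2) e x y z := by
  obtain ⟨hx, hy, hz, hxy, hyz, hxz, h1, h2, h3⟩ := h
  simp only [Finset.mem_erase] at hx hy hz
  refine ⟨hx.2, hy.2, hz.2, hxy, hyz, hxz, h1, h2, ?_⟩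
  have a1 := degIn_erase_le (N e) S w x
  have a2 := degIn_erase_le (N e) S w y
  have a3 := degIn_erase_le (N !e) S w y
  have a4 := degIn_erase_le (N !e) S w z
  have d1 := hdom x hx.2 hx.1
  have d2 := hdom y hy.2 hy.1
  have d3 := hdom z hz.2 hz.1
  by_cases hec : e = c
  · subst hec
    have := degIn_erase_of_adj hw d1.symm
    have := degIn_erase_of_adj hw d2.symm
    omega
  · obtain rfl : c = !e := by cases c <;> cases e <;> simp_all
    have := degIn_erase_of_adj hw d2.symm
    have := degIn_erase_of_adj hw d3.symm
    omega

/-- Either the triple ends at `y`, gaining from its edges in the other colour, or it avoids `y`,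
where `D - 2` suffices. Here `K` counts the missing edges besides the `S.card - 1` forced at `y`. -/
lemma exists_isReducible_of_dominated {N : Bool → SimpleGraph V} {S : Finset V} {K D : ℕ}
    {c : Bool} {y : V} (hy : y ∈ S) (hdom : ∀ v ∈ S, v ≠ y → (N c).Adj y v)
    (hT : degSum (N true) S + degSum (N false) S = 2 * (K + (S.card - 1)))
    (hm : 3 ≤ S.card) (hK : K + 3 ≤ S.card)
    (hD : D ≤ 2 ∨ (D = 3 ∧ 1 ≤ K) ∨ (D = 4 ∧ 3 ≤ K) ∨ (D = 5 ∧ K = 6 ∧ S.card = 9)) :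
    ∃ c x y z, IsReducible N S D c x y z := by
  classical
  have hcard : (S.erase y).card = S.card - 1 := Finset.card_erase_of_mem hy
  have hdy : degIn (N c) S y = S.card - 1 := by
    unfold degIn
    rw [← hcard]
    congr 1
    ext v
    simp only [Finset.mem_filter, Finset.mem_erase]
    exact ⟨fun h => ⟨h.2.ne', h.1⟩, fun h => ⟨h.2, hdom v h.2 h.1⟩⟩
  have hT' : degSum (N c) S + degSum (N !c) S = 2 * (K + (S.card - 1)) := by
    cases c <;> simp only [Bool.not_true, Bool.not_false] <;> omega
  set β := degIn (N !c) S y with hβ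
  have hH : degSum (N c) (S.erase y) + degSum (N !c) (S.erase y) + 2 * β = 2 * K := by
    have := degSum_erase (N c) hy
    have := degSum_erase (N !c) hy
    omega
  have hHt : degSum (N true) (S.erase y) + degSum (N false) (S.erase y) = 2 * (K - β) := by
    cases c <;> simp only [Bool.not_true, Bool.not_false] at hH <;> omega
  have hle : ∀ d, ∀ u ∈ S.erase y, degIn (N d) (S.erase y) u + β ≤ K := by
    intro d u hu
    have := two_mul_degIn_le_degSum (N d) hu
    cases d <;> omega
  obtain ⟨u, huS, huy, hu⟩ := exists_not_adj (N !c) hy (by omega)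
  have huH : u ∈ S.erase y := Finset.mem_erase.mpr ⟨huy, huS⟩
  have hend : D ≤ β + degIn (N c) (S.erase y) u + degIn (N !c) (S.erase y) u + 2 →
      ∃ c x y z, IsReducible N S D c x y z := fun h =>
    exists_isReducible_of_dominated_end hy hdom huS huy hu (by have := hle c u huH; omega) h
  by_cases hDβ : D ≤ β + 2
  · exact hend (by omega)
  obtain ⟨D, rfl⟩ : ∃ D', D = D' + 2 := ⟨D - 2, by omega⟩
  by_cases hex : ∃ w ∈ S.erase y,
      D ≤ degIn (N true) (S.erase y) w + degIn (N false) (S.erase y) w + 1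
  · obtain ⟨e, x, w, z, h⟩ := exists_isReducible_of_no_dominated (D := D) (by omega) hHt
      (fun d v hv => by have := hle d v hv; omega) (by omega) (by omega) hex (fun _ => by
        obtain h | h | h | h : D = 0 ∨ D = 1 ∨ D = 2 ∨ D = 3 := by omega
        all_goals subst h; omega)
    exact ⟨e, x, w, z, h.of_erase hy hdom⟩
  · push Not at hex
    have hsum : ∑ w ∈ S.erase y, (degIn (N true) (S.erase y) w + degIn (N false) (S.erase y) w)
        = 2 * (K - β) := by
      rw [Finset.sum_add_distrib]; exact hHt
    have hb := Finset.sum_le_card_nsmul (S.erase y)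
      (fun w => degIn (N true) (S.erase y) w + degIn (N false) (S.erase y) w) (D - 2)
      fun w hw => by have := hex w hw; omega
    have hu1 : D = 3 → degIn (N true) (S.erase y) u + degIn (N false) (S.erase y) u = 0 →
        2 * (K - β) ≤ 7 := by
      intro hD3 h0
      rw [← hsum, ← Finset.add_sum_erase _ _ huH, h0, zero_add]
      have hb := Finset.sum_le_card_nsmul ((S.erase y).erase u)
        (fun w => degIn (N true) (S.erase y) w + degIn (N false) (S.erase y) w) 1
        fun w hw => by have := hex w (Finset.mem_of_mem_erase hw); omega
      rw [Finset.card_erase_of_mem huH, hcard] at hb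
      simp only [smul_eq_mul, mul_one] at hb
      omega
    rw [hsum, hcard, smul_eq_mul] at hb
    obtain rfl | rfl : D = 2 ∨ D = 3 := by
      have := hex u huH
      omega
    · omega
    -- Tight case on nine vertices: `β = 2` and all eight other vertices have degree one off `y`, so
    -- `u` supplies the last edge.
    · refine hend ?_
      have : degIn (N c) (S.erase y) u + degIn (N !c) (S.erase y) u
          = degIn (N true) (S.erase y) u + degIn (N false) (S.erase y) u := by
        cases c
        exacts [add_comm _ _, rfl]
      omega

/-! ### The numerical bound and the induction -/

/-- The number of edges that may be removed from the complete `2`-edge-coloured multigraph on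
`n` vertices without destroying all alternating Hamiltonian paths. -/
def removableBound (n : ℕ) : ℕ :=
  match n with
  | 2 => 1
  | 3 => 2
  -- For `n = 5` and `n = 7`, removing a one-coloured complete graph on 4 or 5 vertices (6 or 10
  -- edges) leaves too small a matching in that colour, so `2 * n - 4` is one too many.
  | 5 => 5
  | 7 => 9
  | n => 2 * n - 4

lemma removableBound_of_ne {n : ℕ} (h2 : n ≠ 2) (h3 : n ≠ 3) (h5 : n ≠ 5) (h7 : n ≠ 7) :
    removableBound n = 2 * n - 4 := by
  unfold removableBound
  split <;> first | contradiction | rfl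

/-- The numerical conditions under which a reduction is found; here `T` is the number of removed
edges and `D` the number of them to be destroyed by the reduction. -/
lemma removableBound_step {n T D : ℕ} (hn : 3 ≤ n) (hT : T ≤ removableBound n)
    (hD : D = T - removableBound (n - 2)) :
    T + 4 ≤ 2 * n ∧ D + 1 ≤ n ∧ (2 ≤ D → n * (D - 2) < 2 * T) ∧ (1 ≤ D → D * (D - 1) < 2 * T) ∧
      ∀ K, T = K + (n - 1) → (D ≤ 2 ∨ (D = 3 ∧ 1 ≤ K) ∨ (D = 4 ∧ 3 ≤ K) ∨
        (D = 5 ∧ K = 6 ∧ n = 9)) := by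
  rcases Nat.lt_or_ge n 10 with h | h
  · have : D ≤ 5 := by
      interval_cases n <;> simp [removableBound] at hT hD <;> omega
    interval_cases n <;> simp [removableBound] at hT hD <;> interval_cases D <;>
      (refine ⟨?_, ?_, ?_, ?_, fun K hK => ?_⟩ <;> omega)
  · rw [removableBound_of_ne (by omega) (by omega) (by omega) (by omega)] at hT hD
    have : D ≤ 4 := by omega
    interval_cases D <;> (refine ⟨?_, ?_, ?_, ?_, fun K hK => ?_⟩ <;> omega)

lemma exists_isReducible {N : Bool → SimpleGraph V} {S : Finset V} {T : ℕ}
    (hn : 3 ≤ S.card) (hT : degSum (N true) S + degSum (N false) S = 2 * T)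
    (hTn : T ≤ removableBound S.card) :
    ∃ c x y z, IsReducible N S (T - removableBound (S.card - 2)) c x y z := by
  classical
  obtain ⟨h1, h2, h3, h4, h5⟩ := removableBound_step hn hTn rfl
  set D := T - removableBound (S.card - 2)
  by_cases hiso : ∀ c, ∀ u ∈ S, degIn (N c) S u + 2 ≤ S.card
  · refine exists_isReducible_of_no_dominated hn hT hiso h1 h2 ?_ h4
    -- Otherwise all total degrees are at most `D - 2`, against `n * (D - 2) < 2 * T`.
    by_contra! hno
    obtain ⟨y, hy⟩ := Finset.card_pos.mp (show 0 < S.card by omega)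
    have hD2 := hno y hy
    have hb := Finset.sum_le_card_nsmul S
      (fun w => degIn (N true) S w + degIn (N false) S w) (D - 2)
      fun w hw => by have := hno w hw; omega
    rw [Finset.sum_add_distrib, smul_eq_mul] at hb
    have := h3 (by omega)
    unfold degSum at hT
    omega
  · push Not at hiso
    obtain ⟨c, y, hy, hlt⟩ := hiso
    have hc := card_filter_not_adj (N c) hy
    have hdom : ∀ v ∈ S, v ≠ y → (N c).Adj y v := by
      intro v hv hvy
      by_contra hn
      have : 0 < ((S.erase y).filter fun v => ¬ (N c).Adj y v).card :=
        Finset.card_pos.mpr ⟨v, by simp [hv, hvy, hn]⟩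
      omega
    have := two_mul_degIn_le_degSum (N c) hy
    have hTK : T = (T - (S.card - 1)) + (S.card - 1) := by
      cases c <;> omega
    exact exists_isReducible_of_dominated hy hdom (hTK ▸ hT) hn (by omega) (h5 _ hTK)

theorem hasPath_of_degSum_le (n : ℕ) (hn : 1 ≤ n) : ∀ (N : Bool → SimpleGraph V) (S : Finset V),
    S.card = n → degSum (N true) S + degSum (N false) S ≤ 2 * removableBound n →
    HasPath N S := by
  classical
  induction n using Nat.strong_induction_on with
  | _ n ih =>
  intro N S hS hle
  obtain rfl | rfl | hn3 : n = 1 ∨ n = 2 ∨ 3 ≤ n := by omega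
  · obtain ⟨a, rfl⟩ := Finset.card_eq_one.mp hS
    exact ⟨[(a, true)], by simp, by simp, .singleton _⟩
  · obtain ⟨a, b, hab, rfl⟩ := Finset.card_eq_two.mp hS
    obtain ⟨c, hc⟩ : ∃ c, ¬ (N c).Adj a b := by
      by_contra! hadj
      have h : ∀ c, 2 ≤ degSum (N c) {a, b} := fun c => by
        have h1 := two_mul_degIn_le_degSum (N c) (S := {a, b}) (u := a) (by simp)
        have h2 := degIn_pos (S := {a, b}) (by simp) (hadj c)
        omega
      have h1 := h true
      have h2 := h false
      simp only [removableBound] at hle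
      omega
    exact ⟨[(a, c), (b, !c)], by simp [hab], by simp, by simp [Step, hc]⟩
  · obtain ⟨r, hr⟩ := even_degSum (N true) S
    obtain ⟨s, hs⟩ := even_degSum (N false) S
    obtain ⟨c, x, y, z, hx, hy, hz, hxy, hyz, hxz, h1, h2, hD⟩ :=
      exists_isReducible (N := N) (S := S) (T := r + s) (by omega) (by omega)
        (by rw [hS]; omega)
    refine hasPath_of_contract hx hy hz hxy hyz hxz h1 h2
      (ih (n - 2) (by omega) (by omega) _ _ ?_ ?_)
    · rw [Finset.card_erase_of_mem (Finset.mem_erase.mpr ⟨hyz.symm, hz⟩),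
        Finset.card_erase_of_mem hy]
      omega
    · have := degSum_contract N hx hy hz hxy hyz hxz h1 h2
      rw [hS] at hD
      cases c <;> simp only [Bool.not_true, Bool.not_false] at this hD <;> omega

/-! ### From multigraphs to missing edges -/

variable {E : Type*}

/-- The pairs of distinct vertices not joined by an edge of colour `c`. -/
def missing (G : EdgeColouredMultigraph V E 2) (c : Bool) : SimpleGraph V :=
  (SimpleGraph.fromEdgeSet {p | ∃ e, G.ends e = p ∧ finTwoEquiv (G.colour e) = c})ᶜ

lemma exists_edge_of_not_missing {G : EdgeColouredMultigraph V E 2} {c : Bool} {u v : V}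
    (huv : u ≠ v) (h : ¬ (missing G c).Adj u v) :
    ∃ e, G.ends e = s(u, v) ∧ finTwoEquiv (G.colour e) = c := by
  simpa [missing, huv] using h

lemma degSum_missing_add_le [Fintype V] [Fintype E] (G : EdgeColouredMultigraph V E 2) (c : Bool) :
    degSum (missing G c) Finset.univ
        + 2 * (Finset.univ.filter fun e => finTwoEquiv (G.colour e) = c).card
      ≤ Fintype.card V * (Fintype.card V - 1) := by
  classical
  set P := SimpleGraph.fromEdgeSet {p | ∃ e, G.ends e = p ∧ finTwoEquiv (G.colour e) = c} with hP
  have hcard : 2 * (Finset.univ.filter fun e => finTwoEquiv (G.colour e) = c).card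
      ≤ ∑ v, P.degree v := by
    rw [P.sum_degrees_eq_twice_card_edges]
    refine Nat.mul_le_mul_left 2 <| Finset.card_le_card_of_injOn G.ends (fun e he => ?_) fun e he f hf hef => ?_
    · simp only [Finset.coe_filter, Finset.mem_univ, true_and, Set.mem_ofPred_eq] at he
      simp only [SimpleGraph.coe_edgeFinset, hP, SimpleGraph.edgeSet_fromEdgeSet]
      exact ⟨⟨e, rfl, he⟩, G.not_isDiag e⟩
    · simp only [Finset.coe_filter, Finset.mem_univ, true_and, Set.mem_ofPred_eq] at he hf
      exact G.eq_of_parallel e f hef (finTwoEquiv.injective (he.trans hf.symm))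
  have hdeg : ∀ v, degIn (missing G c) Finset.univ v + P.degree v = Fintype.card V - 1 := by
    intro v
    have h1 : degIn (missing G c) Finset.univ v = Pᶜ.degree v := by
      unfold degIn
      rw [← SimpleGraph.card_neighborFinset_eq_degree, SimpleGraph.neighborFinset_eq_filter]
      congr!
    have h2 := P.degree_compl v
    have h3 := P.degree_lt_card_verts v
    omega
  have hsum : degSum (missing G c) Finset.univ + ∑ v, P.degree v
      = Fintype.card V * (Fintype.card V - 1) := by
    rw [degSum, ← Finset.sum_add_distrib, Finset.sum_congr rfl fun v _ => hdeg v]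
    simp
  omega

lemma hasProperHamiltonianPath_of_hasPath [Fintype V] [Nonempty V]
    {G : EdgeColouredMultigraph V E 2} (h : HasPath (missing G) Finset.univ) :
    G.HasProperHamiltonianPath := by
  obtain ⟨L, hnd, hmem, hch⟩ := h
  have hpos : 0 < L.length := by
    have := (hmem (Classical.arbitrary V)).mpr (Finset.mem_univ _)
    rw [← List.length_map (f := Prod.fst)]
    exact List.length_pos_of_mem this
  obtain ⟨k, hk⟩ : ∃ k, L.length = k + 1 := ⟨L.length - 1, by omega⟩
  rw [List.isChain_iff_getElem] at hch
  have hinj : ∀ i j (hi : i < L.length) (hj : j < L.length), L[i].1 = L[j].1 → i = j := by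
    intro i j hi hj hij
    exact (hnd.getElem_inj_iff (i := i) (j := j) (hi := by simpa using hi)
      (hj := by simpa using hj)).mp (by simpa using hij)
  have hedge : ∀ i : Fin k, ∃ e, G.ends e = s(L[i.1].1, L[i.1 + 1].1) ∧
      finTwoEquiv (G.colour e) = L[i.1].2 := by
    intro i
    refine exists_edge_of_not_missing (fun h => ?_) (hch i.1 (by omega)).2
    have := hinj _ _ _ _ h
    omega
  choose f hf1 hf2 using hedge
  refine ⟨k, ⟨fun i => L[i.1].1, f, fun i j hij => Fin.ext (hinj _ _ _ _ hij), hf1⟩, ?_, ?_⟩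
  · intro v
    obtain ⟨p, hp, rfl⟩ := List.mem_map.mp ((hmem v).mpr (Finset.mem_univ v))
    obtain ⟨i, hi, rfl⟩ := List.getElem_of_mem hp
    exact ⟨⟨i, by omega⟩, rfl⟩
  · rintro ⟨i, hi⟩ ⟨j, hj⟩ hij heq
    obtain rfl : i + 1 = j := hij
    have h1 := hf2 ⟨i, hi⟩
    have h2 := hf2 ⟨i + 1, hj⟩
    have h3 := (hch i (by omega)).1
    simp only at heq h1 h2
    rw [heq, h2] at h1
    rw [h1] at h3
    simp at h3

lemma choose_two_add_choose_two_sub {n : ℕ} (hn : 2 ≤ n) :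
    2 * (n.choose 2 + (n - 2).choose 2) + 2 * (2 * n - 3) = 2 * (n * (n - 1)) := by
  obtain ⟨m, rfl⟩ := Nat.exists_eq_add_of_le' hn
  have h1 := Nat.triangle_succ (m + 1)
  have h2 : ∀ a : ℕ, a * (a - 1) / 2 * 2 = a * (a - 1) := fun a =>
    Nat.div_mul_cancel (Nat.even_mul_pred_self a).two_dvd
  have h3 := h2 (m + 2)
  have h4 := h2 m
  rw [Nat.choose_two_right, Nat.choose_two_right, Nat.add_sub_cancel]
  have h5 : (m + 2) * (m + 2 - 1) = m * (m - 1) + (4 * m + 2) := by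
    rcases m with _ | m
    · rfl
    · simp only [Nat.add_sub_cancel, show m + 1 + 2 - 1 = m + 2 by omega]; ring
  omega

lemma hasProperHamiltonianPath_of_card_edges [Fintype V] [Fintype E]
    (G : EdgeColouredMultigraph V E 2) (hn : 8 ≤ Fintype.card V)
    (hE : (Fintype.card V).choose 2 + (Fintype.card V - 2).choose 2 + 1 ≤ Fintype.card E) :
    G.HasProperHamiltonianPath := by
  have : Nonempty V := Fintype.card_pos_iff.mp (by omega)
  refine hasProperHamiltonianPath_of_hasPath
    (hasPath_of_degSum_le (Fintype.card V) (by omega) _ _ Finset.card_univ ?_)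
  rw [removableBound_of_ne (by omega) (by omega) (by omega) (by omega)]
  have h1 := degSum_missing_add_le G true
  have h2 := degSum_missing_add_le G false
  have h3 := choose_two_add_choose_two_sub (n := Fintype.card V) (by omega)
  have h4 := Finset.card_filter_add_card_filter_not (s := (Finset.univ : Finset E))
    (fun e => finTwoEquiv (G.colour e) = true)
  simp only [Bool.not_eq_true, Finset.card_univ] at h4
  omega

/-! ### The extremal example -/

lemma addNat_two_injective (m : ℕ) : Function.Injective (Fin.addNat · 2 : Fin m → Fin (m + 2)) :=
  fun a b h => by simpa [Fin.ext_iff] using h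

/-- The complete graph on `m + 2` vertices in one colour and the complete graph on the last `m`
of them in the other colour. -/
def completeWithSubgraph (m : ℕ) : EdgeColouredMultigraph (Fin (m + 2))
    ({p : Sym2 (Fin (m + 2)) // ¬ p.IsDiag} ⊕ {p : Sym2 (Fin m) // ¬ p.IsDiag}) 2 where
  ends := Sum.elim (fun p => p.1) fun p => p.1.map (Fin.addNat · 2)
  not_isDiag := by
    rintro (⟨p, hp⟩ | ⟨p, hp⟩)
    · exact hp
    · exact fun h => hp ((Sym2.isDiag_map (addNat_two_injective m)).mp h)
  colour := Sum.elim (fun _ => 0) fun _ => 1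
  eq_of_parallel := by
    rintro (⟨p, hp⟩ | ⟨p, hp⟩) (⟨q, hq⟩ | ⟨q, hq⟩) h hc
    · simpa using h
    · simp at hc
    · simp at hc
    · exact congrArg _ (Subtype.ext (Sym2.map.injective (addNat_two_injective m) h))

lemma two_le_of_colour_eq_one {m : ℕ} {e} (h : (completeWithSubgraph m).colour e = 1)
    {v : Fin (m + 2)} (hv : v ∈ (completeWithSubgraph m).ends e) : 2 ≤ v.1 := by
  rcases e with p | ⟨p, hp⟩
  · simp [completeWithSubgraph] at h
  · simp only [completeWithSubgraph, Sum.elim_inr, Sym2.mem_map] at hv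
    obtain ⟨a, -, rfl⟩ := hv
    simp

lemma connected_completeWithSubgraph (m : ℕ) : (completeWithSubgraph m).underlying.Connected := by
  have : (completeWithSubgraph m).underlying = ⊤ := by
    ext x y
    refine ⟨fun h => h.ne, fun h => ⟨.inl ⟨s(x, y), by simpa using h⟩, rfl⟩⟩
  rw [this]
  exact SimpleGraph.connected_top

lemma colour_eq_iff_even {G : EdgeColouredMultigraph V E 2} {k : ℕ} {P : G.Path k}
    (hP : P.IsProper) (h0 : 0 < k) (i : ℕ) (hi : i < k) :
    G.colour (P.edge ⟨i, hi⟩) = G.colour (P.edge ⟨0, h0⟩) ↔ Even i := by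
  induction i with
  | zero => simp
  | succ i ih =>
    have h1 := ih (by omega)
    have h2 := hP ⟨i, by omega⟩ ⟨i + 1, hi⟩ rfl
    rw [Nat.even_add_one, ← h1]
    omega

lemma not_hasProperHamiltonianPath_completeWithSubgraph {m : ℕ} (hm : Odd m) :
    ¬ (completeWithSubgraph m).HasProperHamiltonianPath := by
  rintro ⟨k, P, hH, hP⟩
  have hk : k + 1 = m + 2 := by
    simpa using Fintype.card_congr (Equiv.ofBijective P.vert ⟨P.vert_injective, hH⟩)
  have hk2 : 2 ≤ k := by have := hm.pos; omega
  obtain ⟨a, ha⟩ := hH ⟨0, by omega⟩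
  obtain ⟨b, hb⟩ := hH ⟨1, by omega⟩
  have hab : a ≠ b := by
    rintro rfl
    rw [ha] at hb
    simp at hb
  have hl : ∀ j (hj : j < k), (P.vert (Fin.castSucc ⟨j, hj⟩)).1 < 2 →
      (completeWithSubgraph m).colour (P.edge ⟨j, hj⟩) = 0 := by
    intro j hj hlt
    by_contra h
    have := two_le_of_colour_eq_one (e := P.edge ⟨j, hj⟩) (by omega)
      (v := P.vert (Fin.castSucc ⟨j, hj⟩)) (by rw [P.ends_edge]; simp)
    omega
  have hr : ∀ j (hj : j < k), (P.vert (Fin.succ ⟨j, hj⟩)).1 < 2 →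
      (completeWithSubgraph m).colour (P.edge ⟨j, hj⟩) = 0 := by
    intro j hj hlt
    by_contra h
    have := two_le_of_colour_eq_one (e := P.edge ⟨j, hj⟩) (by omega)
      (v := P.vert (Fin.succ ⟨j, hj⟩)) (by rw [P.ends_edge]; simp)
    omega
  -- An interior vertex of a proper path meets both colours, but vertices `0` and `1` meet only
  -- colour `0`.
  have hends : ∀ i : Fin (k + 1), (P.vert i).1 < 2 → i.1 = 0 ∨ i.1 = k := by
    intro i hi
    by_contra! hne
    obtain ⟨j, hj⟩ : ∃ j, i.1 = j + 1 := ⟨i.1 - 1, by omega⟩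
    have e1 : i = Fin.succ ⟨j, by omega⟩ := Fin.ext (by simp [hj])
    have e2 : i = Fin.castSucc ⟨j + 1, by omega⟩ := Fin.ext (by simp [hj])
    have c1 := hr j (by omega) (e1 ▸ hi)
    have c2 := hl (j + 1) (by omega) (e2 ▸ hi)
    exact hP ⟨j, by omega⟩ ⟨j + 1, by omega⟩ rfl (c1.trans c2.symm)
  have hA := hends a (by rw [ha]; simp)
  have hB := hends b (by rw [hb]; simp)
  have hab' : a.1 ≠ b.1 := fun h => hab (Fin.ext h)
  obtain ⟨p, q, hp, hq, hp2, hq2⟩ : ∃ p q : Fin (k + 1), p.1 = 0 ∧ q.1 = k ∧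
      (P.vert p).1 < 2 ∧ (P.vert q).1 < 2 := by
    rcases hA with h | h
    · exact ⟨a, b, h, by omega, by rw [ha]; simp, by rw [hb]; simp⟩
    · exact ⟨b, a, by omega, h, by rw [hb]; simp, by rw [ha]; simp⟩
  have e1 : p = Fin.castSucc ⟨0, by omega⟩ := Fin.ext (by simp [hp])
  have e2 : q = Fin.succ ⟨k - 1, by omega⟩ := Fin.ext (by simp [hq]; omega)
  have c1 := hl 0 (by omega) (e1 ▸ hp2)
  have c2 := hr (k - 1) (by omega) (e2 ▸ hq2)
  have hev := (colour_eq_iff_even hP (by omega) (k - 1) (by omega)).mp (c2.trans c1.symm)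
  rw [show k - 1 = m by omega] at hev
  exact Nat.not_even_iff_odd.mpr hm hev

end AlternatingPath

theorem theorem1 (n : ℕ) (hn : 8 ≤ n) :
    (∀ (V : Type u) (E : Type v) [Fintype V] [Fintype E] (G : EdgeColouredMultigraph V E 2),
      Fintype.card V = n →
      n.choose 2 + (n - 2).choose 2 + 1 ≤ Fintype.card E →
      G.HasProperHamiltonianPath) ∧
    (Odd n →
      ∃ (E : Type) (_ : Fintype E) (G : EdgeColouredMultigraph (Fin n) E 2),
        G.underlying.Connected ∧
        Fintype.card E = n.choose 2 + (n - 2).choose 2 ∧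
        ¬ G.HasProperHamiltonianPath) := by
  refine ⟨fun V E _ _ G hV hE => ?_, fun hodd => ?_⟩
  · subst hV
    exact AlternatingPath.hasProperHamiltonianPath_of_card_edges G hn hE
  · classical
    obtain ⟨m, rfl⟩ := Nat.exists_eq_add_of_le' (show 2 ≤ n by omega)
    refine ⟨_, inferInstance, AlternatingPath.completeWithSubgraph m,
      AlternatingPath.connected_completeWithSubgraph m, ?_,
      AlternatingPath.not_hasProperHamiltonianPath_completeWithSubgraph (by grind)⟩
    rw [Fintype.card_sum, Sym2.card_subtype_not_diag, Sym2.card_subtype_not_diag]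
    simp
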